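/- Theorem (Existence of extreme states). Let $U$ be a connected $1$-linkoid universe in $S^2$: a finite connected graph embedded in the oriented sphere, all of whose vertices are $4$-valent (the crossings) except two univalent vertices, the endpoints, called tail and head. Place a star in the region containing the tail; this region is drawn as the exterior region. A clock state of $U$ is a choice of markers at corners of crossings such that each crossing has exactly one marker, each unstarred region has exactly one marker, and the starred region has none. A clock move turns markers by $90$ degrees at their crossings, either all clockwise or all counterclockwise, and yields another clock state. It turns either (a) two markers lying in distinct regions that share a boundary edge, possibly with a knotted portion inserted in that edge, each marker passing one end of that edge, so that the markers exchange their regions; or (b) a single marker that stays in its region, passing an edge that has this region on both sides, such as the edge at the head (thus an edge leading towards the head, possibly with another $1$-linkoid universe inserted in between). A state is clocked if it admits no counterclockwise clock move, and counter-clocked if it admits no clockwise clock move; a state with no clock moves at all is thus both. Then $U$ has a clocked state and a counter-clocked state. -/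

import Mathlib

/-- The universe of a connected starred 1-linkoid diagram in the (oriented) sphere, up to
orientation preserving homeomorphism, presented as a combinatorial map on its set `D` of
half-edges. A vertex is a cycle of `rot`, an edge is a cycle of `opp`. Every vertex is a 4-valent
crossing, except two univalent vertices, the endpoints `tail` and `head`. The star is in the region
that contains the tail (see `starRegion`), which is drawn as the exterior region. -/
structure OneLinkoidUniverse (D : Type*) where
  /-- the other half of the same edge -/
  opp : Equiv.Perm D
  /-- the next half-edge, counterclockwise, at the same vertex -/
  rot : Equiv.Perm D
  /-- the half-edge at the tail -/
  tail : D
  /-- the half-edge at the head -/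
  head : D
  opp_opp : ∀ d, opp (opp d) = d
  opp_ne : ∀ d, opp d ≠ d
  tail_ne_head : tail ≠ head
  rot_tail : rot tail = tail
  rot_head : rot head = head
  four_valent : ∀ d, d ≠ tail → d ≠ head → Function.minimalPeriod rot d = 4
  /-- the universe is connected -/
  connected : MulAction.IsPretransitive (Subgroup.closure {opp, rot}) D
  /-- Euler's formula `V + F = E + 2`: the surface in which the regions are discs is the sphere.
  The next half-edge on the boundary of the region on the left of `d` is `rot⁻¹ (opp d)`. -/
  planar :
    Nat.card (Quotient (Equiv.Perm.SameCycle.setoid rot)) +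
        Nat.card (Quotient (Equiv.Perm.SameCycle.setoid (rot⁻¹ * opp))) =
      Nat.card (Quotient (Equiv.Perm.SameCycle.setoid opp)) + 2

namespace OneLinkoidUniverse

variable {D : Type*} (U : OneLinkoidUniverse D)

/-- The vertices: the crossings and the two endpoints. -/
def Vertex : Type _ := Quotient (Equiv.Perm.SameCycle.setoid U.rot)

/-- The vertex of a half-edge. -/
def vertex (d : D) : U.Vertex := Quotient.mk (Equiv.Perm.SameCycle.setoid U.rot) d

/-- The crossings are the vertices other than the two endpoints. -/
def IsCrossing (v : U.Vertex) : Prop := v ≠ U.vertex U.tail ∧ v ≠ U.vertex U.head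

/-- The regions of the universe in the sphere. -/
def Region : Type _ := Quotient (Equiv.Perm.SameCycle.setoid (U.rot⁻¹ * U.opp))

/-- A half-edge `d` also names a corner: the sector at the vertex of `d` between the half-edges `d`
and `U.rot d`. This is the region in which that corner lies, the one on the left of `d`. -/
def region (d : D) : U.Region := Quotient.mk (Equiv.Perm.SameCycle.setoid (U.rot⁻¹ * U.opp)) d

/-- The starred region, the one that contains the tail. -/
def starRegion : U.Region := U.region U.tail

/-- A clock state: a set of marked corners at crossings, such that the starred region has no
marker, every other region has exactly one marker, and every crossing has exactly one marker. -/
structure ClockState where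
  /-- the marked corners -/
  markers : Set D
  isCrossing : ∀ x ∈ markers, U.IsCrossing (U.vertex x)
  not_star : ∀ x ∈ markers, U.region x ≠ U.starRegion
  region_unique : ∀ r : U.Region, r ≠ U.starRegion → ∃! x, x ∈ markers ∧ U.region x = r
  crossing_unique : ∀ v : U.Vertex, U.IsCrossing v → ∃! x, x ∈ markers ∧ U.vertex x = v

variable {U}

namespace ClockState

/-- `s.Move ρ s'`: the state `s'` is obtained from `s` by turning markers by 90 degrees according to
`ρ`, which is `U.rot` (counterclockwise) or `U.rot⁻¹` (clockwise). Either one marker turns and stays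
in its region (the half-edge that it passes has this region on both sides, as the edge at the head
does), or two markers turn and exchange their regions (each of them passes a half-edge that
separates the two regions: the two ends of a common boundary edge, or of such an edge with a
knotted portion inserted). -/
def Move (ρ : Equiv.Perm D) (s s' : U.ClockState) : Prop :=
  (∃ x ∈ s.markers, U.region (ρ x) = U.region x ∧
      s'.markers = (s.markers \ {x}) ∪ {ρ x}) ∨
    ∃ x ∈ s.markers, ∃ y ∈ s.markers, x ≠ y ∧
      U.region (ρ x) = U.region y ∧ U.region (ρ y) = U.region x ∧
      s'.markers = (s.markers \ {x, y}) ∪ {ρ x, ρ y}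

/-- A counterclockwise clock move. -/
def CounterclockwiseMove (s s' : U.ClockState) : Prop := s.Move U.rot s'

/-- A clockwise clock move. -/
def ClockwiseMove (s s' : U.ClockState) : Prop := s.Move U.rot⁻¹ s'

/-- A state is clocked if it admits clock moves only in the clockwise direction. (As is the
convention, a state that admits no clock move at all is clocked and counter-clocked.) -/
def IsClocked (s : U.ClockState) : Prop := ¬ ∃ s' : U.ClockState, s.CounterclockwiseMove s'

/-- A state is counter-clocked if it admits clock moves only in the counterclockwise direction. -/
def IsCounterClocked (s : U.ClockState) : Prop := ¬ ∃ s' : U.ClockState, s.ClockwiseMove s'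

end ClockState

end OneLinkoidUniverse

/-!
The theorem follows from two facts: a universe has a clock state, and some function on the clock
states decreases strictly under counterclockwise moves. As the set of states is finite, a state that
minimizes this function is clocked, and one that maximizes it is counter-clocked. Both facts are
obtained by linear algebra over `ℚ`, in which the sphere enters only through Euler's formula.

*Existence of a state* (`nonempty_clockState`). By Euler's formula there are as many crossings as
unstarred regions. Orient all strands and consider functions of regions which vanish at the star
and, for each crossing, jump by the same amount across its two outgoing half-edges. These conditions
form a square matrix whose entry at a crossing and a region can be nonzero only if the region has a
corner at the crossing. An energy identity (`region_eq_of_jump_eq`) shows that the matrix is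
nonsingular, so that a nonzero term of its determinant gives the state.

*The decreasing function* (`ClockState.exists_strictAnti`). The difference of the indicator
functions of two states is a function of corners that sums to zero around each vertex and in each
region. Since the first cohomology of the sphere vanishes (`exists_potential`), it is the difference
along the corners of a function of edges, which is unique if it is required to vanish at the tail.
This is a height function as for perfect matchings of a plane bipartite graph. The total of the
heights, relative to a fixed state, is the function in question.

Under a counterclockwise move the height drops by one when a turned marker passes an edge, as seen
from the crossing of the marker. So it remains to see that this crossing is on the side of the tail,
that is, that it can be joined to the tail without using the passed edges. Otherwise consider the
part of the universe that cannot be so joined. It is cut off by at most two edges and contains at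
most one endpoint. An Euler inequality (`card_add_one_le_of_connected`) shows that the number of
its crossings is at most the number of regions all of whose corners belong to this part. The markers
in these regions are all at these crossings, so each crossing in this part has its marker in such a
region (`ClockState.mem_of_region_eq`). But a turned marker lies in a region on a side of a cut
edge.
-/

/-! ### Alternating sets for two involutions -/

/-- Two involutions without fixed points admit a set that both of them exchange with its complement:
their orbits are alternating paths or alternating cycles of even length. -/
theorem exists_forall_apply_mem_iff_notMem {X : Type*} {a b : X → X} (ha : a.Involutive)
    (ha' : ∀ x, a x ≠ x) (hb : b.Involutive) (hb' : ∀ x, b x ≠ x) :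
    ∃ O : Set X, (∀ x, a x ∈ O ↔ x ∉ O) ∧ ∀ x, b x ∈ O ↔ x ∉ O := by
  classical
  let c : Equiv.Perm X := ha.toPerm * hb.toPerm
  have hc : ∀ x, c x = a (b x) := fun _ => rfl
  have hc' : ∀ x, c⁻¹ x = b (a x) := fun x => by
    rw [Equiv.Perm.inv_eq_iff_eq, hc, hb, ha]
  have hac : ∀ (i : ℤ) x, a ((c ^ i) x) = (c ^ (-i)) (a x) := by
    intro i
    induction i using Int.induction_on with
    | zero => simp
    | succ i ih =>
      intro x
      rw [zpow_add_one, Equiv.Perm.mul_apply, ih, hc, ha, neg_add, zpow_add, zpow_neg_one,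
        Equiv.Perm.mul_apply, hc', ha]
    | pred i ih =>
      intro x
      rw [zpow_sub_one, Equiv.Perm.mul_apply, ih, hc', neg_sub, sub_eq_add_neg, add_comm, zpow_add,
        zpow_one, Equiv.Perm.mul_apply, hc]
  let q : X → Quotient (Equiv.Perm.SameCycle.setoid c) := fun x => Quotient.mk _ x
  have hq : ∀ {x y}, q x = q y ↔ c.SameCycle x y :=
    Quotient.eq (r := Equiv.Perm.SameCycle.setoid c)
  -- `a` maps no cycle of `c = a ∘ b` to itself: the reflections of a cycle have fixed points
  have hne : ∀ x, q x ≠ q (a x) := by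
    intro x h
    obtain ⟨i, hi⟩ := hq.1 h
    obtain ⟨j, rfl | rfl⟩ := Int.even_or_odd' i
    · refine ha' ((c ^ j) x) ?_
      rw [hac, ← hi, ← Equiv.Perm.mul_apply, ← zpow_add]
      congr 2
      ring
    · refine hb' ((c ^ j) x) (ha.injective ?_)
      rw [← hc, hac, ← hi, ← Equiv.Perm.mul_apply, ← Equiv.Perm.mul_apply, ← zpow_one_add,
        ← zpow_add]
      congr 2
      ring
  have hqb : ∀ x, q (b x) = q (a x) := fun x => by
    rw [hq]
    exact ⟨1, by rw [zpow_one, hc, hb]⟩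
  have hqab : ∀ x, q (a (b x)) = q x := fun x => by
    rw [hq]
    exact ⟨-1, by rw [zpow_neg_one, hc', ha, hb]⟩
  have htri : ∀ x, WellOrderingRel (q (a x)) (q x) ↔ ¬ WellOrderingRel (q x) (q (a x)) :=
    fun x => ⟨fun h h' => asymm_of WellOrderingRel h h', fun h =>
      ((trichotomous_of WellOrderingRel (q x) (q (a x))).resolve_left h).resolve_left (hne x)⟩
  refine ⟨{x | WellOrderingRel (q x) (q (a x))}, fun x => ?_, fun x => ?_⟩
  · simp only [Set.mem_ofPred_eq, ha x, htri]
  · simp only [Set.mem_ofPred_eq, hqb, hqab, htri]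

namespace OneLinkoidUniverse

variable {D : Type*} (U : OneLinkoidUniverse D)

/-! ### Half-edges, vertices, edges and regions -/

/-- The edge of a half-edge. -/
def edge (d : D) : Quotient (Equiv.Perm.SameCycle.setoid U.opp) :=
  Quotient.mk (Equiv.Perm.SameCycle.setoid U.opp) d

theorem vertex_eq_iff {d d' : D} : U.vertex d = U.vertex d' ↔ U.rot.SameCycle d d' :=
  Quotient.eq (r := Equiv.Perm.SameCycle.setoid U.rot)

theorem region_eq_iff {d d' : D} :
    U.region d = U.region d' ↔ (U.rot⁻¹ * U.opp).SameCycle d d' :=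
  Quotient.eq (r := Equiv.Perm.SameCycle.setoid (U.rot⁻¹ * U.opp))

theorem edge_eq_iff {d d' : D} : U.edge d = U.edge d' ↔ U.opp.SameCycle d d' :=
  Quotient.eq (r := Equiv.Perm.SameCycle.setoid U.opp)

theorem vertex_surjective : Function.Surjective U.vertex := Quotient.mk_surjective

theorem region_surjective : Function.Surjective U.region := Quotient.mk_surjective

theorem edge_surjective : Function.Surjective U.edge := Quotient.mk_surjective

instance [Finite D] : Finite U.Vertex := Finite.of_surjective _ U.vertex_surjective

instance [Finite D] : Finite U.Region := Finite.of_surjective _ U.region_surjective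

@[simp]
theorem vertex_rot (d : D) : U.vertex (U.rot d) = U.vertex d :=
  U.vertex_eq_iff.2 (Equiv.Perm.sameCycle_apply_left.2 (Equiv.Perm.SameCycle.refl _ _))

theorem rot_apply_inv (d : D) : U.rot (U.rot⁻¹ d) = d := Equiv.apply_symm_apply _ _

@[simp]
theorem vertex_rot_inv (d : D) : U.vertex (U.rot⁻¹ d) = U.vertex d := by
  rw [← U.vertex_rot (U.rot⁻¹ d), rot_apply_inv]

@[simp]
theorem edge_opp (d : D) : U.edge (U.opp d) = U.edge d :=
  U.edge_eq_iff.2 (Equiv.Perm.sameCycle_apply_left.2 (Equiv.Perm.SameCycle.refl _ _))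

theorem region_next (d : D) : U.region (U.rot⁻¹ (U.opp d)) = U.region d :=
  U.region_eq_iff.2 (Equiv.Perm.sameCycle_apply_left (f := U.rot⁻¹ * U.opp).2
    (Equiv.Perm.SameCycle.refl _ _))

/-- The regions on the left of the two halves of an edge are the regions of the two corners on
either side of this edge at one of its ends. -/
theorem region_opp (d : D) : U.region (U.opp d) = U.region (U.rot⁻¹ d) := by
  rw [← U.region_next (U.opp d), U.opp_opp]

/-- A function of half-edges that is invariant under a permutation is constant on its cycles. -/
theorem _root_.Equiv.Perm.SameCycle.apply_eq_of_invariant {α β : Type*} {p : Equiv.Perm α}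
    {h : α → β} (hp : ∀ a, h (p a) = h a) {a b : α} (hab : p.SameCycle a b) : h a = h b := by
  obtain ⟨i, rfl⟩ := hab
  induction i using Int.induction_on with
  | zero => simp
  | succ i ih => rw [ih, add_comm, zpow_add, zpow_one, Equiv.Perm.mul_apply, hp]
  | pred i ih =>
    rw [ih, ← hp ((p ^ (-(i : ℤ) - 1)) a), ← Equiv.Perm.mul_apply, ← zpow_one_add]
    congr 3
    ring

/-- Connectedness: a function of half-edges that does not change along an edge or around a vertex
is constant. -/
theorem eq_of_invariant {α : Sort*} {h : D → α} (ho : ∀ d, h (U.opp d) = h d)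
    (hr : ∀ d, h (U.rot d) = h d) (d d' : D) : h d = h d' := by
  obtain ⟨⟨g, hg⟩, rfl⟩ := U.connected.exists_smul_eq d d'
  change h d = h (g d)
  revert d
  induction hg using Subgroup.closure_induction with
  | mem x hx =>
    rcases hx with rfl | rfl
    · exact fun d => (ho d).symm
    · exact fun d => (hr d).symm
  | one => simp
  | mul x y _ _ hx hy => exact fun d => (hy d).trans (hx (y d))
  | inv x _ hx =>
    intro d
    rw [hx (x⁻¹ d), ← Equiv.Perm.mul_apply, mul_inv_cancel, Equiv.Perm.one_apply]

theorem vertex_eq_tail_iff {d : D} : U.vertex d = U.vertex U.tail ↔ d = U.tail := by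
  refine ⟨fun h => ?_, fun h => h ▸ rfl⟩
  obtain ⟨i, hi⟩ := (U.vertex_eq_iff.1 h).symm
  rw [← hi, Equiv.Perm.zpow_apply_eq_self_of_apply_eq_self U.rot_tail]

theorem vertex_eq_head_iff {d : D} : U.vertex d = U.vertex U.head ↔ d = U.head := by
  refine ⟨fun h => ?_, fun h => h ▸ rfl⟩
  obtain ⟨i, hi⟩ := (U.vertex_eq_iff.1 h).symm
  rw [← hi, Equiv.Perm.zpow_apply_eq_self_of_apply_eq_self U.rot_head]

theorem isCrossing_vertex_iff {d : D} :
    U.IsCrossing (U.vertex d) ↔ d ≠ U.tail ∧ d ≠ U.head := by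
  simp only [IsCrossing, ne_eq, vertex_eq_tail_iff, vertex_eq_head_iff]

theorem minimalPeriod_rot {d : D} (hd : U.IsCrossing (U.vertex d)) :
    Function.minimalPeriod U.rot d = 4 :=
  U.four_valent d (U.isCrossing_vertex_iff.1 hd).1 (U.isCrossing_vertex_iff.1 hd).2

@[simp]
theorem rot_rot_rot_rot (d : D) : U.rot (U.rot (U.rot (U.rot d))) = d := by
  by_cases ht : d = U.tail
  · simp [ht, U.rot_tail]
  by_cases hh : d = U.head
  · simp [hh, U.rot_head]
  have := Function.iterate_minimalPeriod (f := U.rot) (x := d)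
  rwa [U.four_valent d ht hh] at this

theorem rot_inv_apply (d : D) : U.rot⁻¹ d = U.rot (U.rot (U.rot d)) := by
  rw [Equiv.Perm.inv_eq_iff_eq, rot_rot_rot_rot]

theorem rot_ne {d : D} (hd : U.IsCrossing (U.vertex d)) : U.rot d ≠ d := fun h => by
  have := Function.minimalPeriod_eq_one_iff_isFixedPt.2 h
  rw [U.minimalPeriod_rot hd] at this
  omega

theorem rot_rot_ne {d : D} (hd : U.IsCrossing (U.vertex d)) : U.rot (U.rot d) ≠ d := fun h => by
  have : Function.minimalPeriod U.rot d ∣ 2 := Function.IsPeriodicPt.minimalPeriod_dvd h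
  rw [U.minimalPeriod_rot hd] at this
  omega

theorem eq_of_vertex_eq {d d' : D} (h : U.vertex d' = U.vertex d) :
    d' = d ∨ d' = U.rot d ∨ d' = U.rot (U.rot d) ∨ d' = U.rot (U.rot (U.rot d)) := by
  let P : D → Prop := fun d' =>
    d' = d ∨ d' = U.rot d ∨ d' = U.rot (U.rot d) ∨ d' = U.rot (U.rot (U.rot d))
  have hP : ∀ a, P a → P (U.rot a) := by
    rintro a (rfl | rfl | rfl | rfl) <;> simp [P]
  have hP' : ∀ a, P (U.rot a) = P a := fun a => propext
    ⟨fun h => by have := hP _ (hP _ (hP _ h)); rwa [rot_rot_rot_rot] at this, hP a⟩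
  have := Equiv.Perm.SameCycle.apply_eq_of_invariant hP' (U.vertex_eq_iff.1 h)
  exact this.mpr (Or.inl rfl)

theorem eq_of_edge_eq {d d' : D} (h : U.edge d' = U.edge d) : d' = d ∨ d' = U.opp d := by
  have hP : ∀ a, (U.opp a = d ∨ U.opp a = U.opp d) = (a = d ∨ a = U.opp d) := by
    intro a
    rw [U.opp.injective.eq_iff, show U.opp a = d ↔ a = U.opp d from
      ⟨fun h => h ▸ (U.opp_opp a).symm, fun h => h ▸ U.opp_opp d⟩]
    exact propext or_comm
  have := Equiv.Perm.SameCycle.apply_eq_of_invariant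
    (h := fun a => a = d ∨ a = U.opp d) hP (U.edge_eq_iff.1 h)
  exact this.mpr (Or.inl rfl)

/-! ### Counting half-edges -/

open Classical in
theorem two_mul_card_image_edge (S : Finset D) (hS : ∀ d ∈ S, U.opp d ∈ S) :
    2 * (S.image U.edge).card = S.card := by
  rw [Finset.card_eq_sum_card_image U.edge S, Finset.sum_const_nat (m := 2), mul_comm]
  intro e he
  obtain ⟨d, hd, rfl⟩ := Finset.mem_image.1 he
  rw [show S.filter (fun a => U.edge a = U.edge d) = {d, U.opp d} from ?_,
    Finset.card_pair (U.opp_ne d).symm]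
  ext a
  simp only [Finset.mem_filter, Finset.mem_insert, Finset.mem_singleton]
  refine ⟨fun h => U.eq_of_edge_eq h.2, ?_⟩
  rintro (rfl | rfl)
  · exact ⟨hd, rfl⟩
  · exact ⟨hS d hd, U.edge_opp d⟩

open Classical in
theorem card_filter_vertex (S : Finset D) (hS : ∀ d ∈ S, U.rot d ∈ S) {d : D} (hd : d ∈ S) :
    (S.filter (fun a => U.vertex a = U.vertex d)).card =
      if U.IsCrossing (U.vertex d) then 4 else 1 := by
  have hfilter : S.filter (fun a => U.vertex a = U.vertex d) =
      (Finset.range 4).image (fun i => U.rot^[i] d) := by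
    ext a
    simp only [Finset.mem_filter, Finset.mem_image, Finset.mem_range]
    constructor
    · rintro ⟨-, h⟩
      rcases U.eq_of_vertex_eq h with rfl | rfl | rfl | rfl
      exacts [⟨0, by simp⟩, ⟨1, by simp⟩, ⟨2, by simp⟩, ⟨3, by simp⟩]
    · rintro ⟨i, -, rfl⟩
      induction i with
      | zero => exact ⟨hd, rfl⟩
      | succ i ih =>
        rw [Function.iterate_succ_apply']
        exact ⟨hS _ ih.1, (U.vertex_rot _).trans ih.2⟩
  split_ifs with hc
  · rw [hfilter, Finset.card_image_of_injOn, Finset.card_range]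
    intro i hi j hj h
    refine Function.iterate_injOn_Iio_minimalPeriod (f := U.rot) (x := d) ?_ ?_ h
    · rw [U.minimalPeriod_rot hc]; simpa using hi
    · rw [U.minimalPeriod_rot hc]; simpa using hj
  · rw [Finset.card_eq_one]
    refine ⟨d, ?_⟩
    ext a
    simp only [Finset.mem_filter, Finset.mem_singleton]
    refine ⟨fun h => ?_, fun h => by rw [h]; exact ⟨hd, rfl⟩⟩
    rw [IsCrossing, not_and_or, not_not, not_not] at hc
    rcases hc with hc | hc
    · rw [U.vertex_eq_tail_iff.1 hc] at h ⊢
      exact U.vertex_eq_tail_iff.1 h.2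
    · rw [U.vertex_eq_head_iff.1 hc] at h ⊢
      exact U.vertex_eq_head_iff.1 h.2

open Classical in
/-- Counting the half-edges of a union of vertices: all have degree four, except the endpoints,
which have degree one. -/
theorem card_add_three_mul (S : Finset D) (hS : ∀ d ∈ S, U.rot d ∈ S) :
    S.card + 3 * ((S.image U.vertex).filter (fun v => ¬ U.IsCrossing v)).card =
      4 * (S.image U.vertex).card := by
  rw [Finset.card_eq_sum_card_image U.vertex S, Finset.card_filter, Finset.mul_sum,
    ← Finset.sum_add_distrib, mul_comm 4]
  refine Finset.sum_const_nat fun v hv => ?_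
  obtain ⟨d, hd, rfl⟩ := Finset.mem_image.1 hv
  rw [U.card_filter_vertex S hS hd]
  split_ifs <;> simp_all

theorem card_edge [Finite D] :
    2 * Nat.card (Quotient (Equiv.Perm.SameCycle.setoid U.opp)) = Nat.card D := by
  classical
  have := Fintype.ofFinite D
  have := Fintype.ofFinite (Quotient (Equiv.Perm.SameCycle.setoid U.opp))
  rw [Nat.card_eq_fintype_card, Nat.card_eq_fintype_card, ← Finset.card_univ (α := D),
    ← U.two_mul_card_image_edge Finset.univ (by simp),
    Finset.image_univ_of_surjective U.edge_surjective, Finset.card_univ]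

/-- Euler's formula in terms of half-edges. -/
theorem two_mul_card_vertex_add_card_region [Finite D] :
    2 * (Nat.card U.Vertex + Nat.card U.Region) = Nat.card D + 4 := by
  have h := U.planar
  change Nat.card U.Vertex + Nat.card U.Region = _ at h
  rw [h, ← U.card_edge]
  ring

/-- By Euler's formula, there are as many unstarred regions as crossings. -/
theorem card_unstarred [Finite D] :
    Nat.card {r : U.Region // r ≠ U.starRegion} = Nat.card {v : U.Vertex // U.IsCrossing v} := by
  classical
  have := Fintype.ofFinite D
  have := Fintype.ofFinite U.Vertex
  have := Fintype.ofFinite U.Region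
  have h₁ := U.two_mul_card_vertex_add_card_region
  have h₂ := U.card_add_three_mul Finset.univ (by simp)
  have h₃ : (Finset.univ.filter (fun v => ¬ U.IsCrossing v)) =
      {U.vertex U.tail, U.vertex U.head} := by
    ext v
    rw [Finset.mem_filter, Finset.mem_insert, Finset.mem_singleton, IsCrossing, not_and_or, not_not,
      not_not]
    simp
  have h₄ := Finset.card_filter_add_card_filter_not (s := Finset.univ) (fun v => U.IsCrossing v)
  rw [Finset.image_univ_of_surjective U.vertex_surjective, h₃, Finset.card_pair
    (fun h => U.tail_ne_head (U.vertex_eq_head_iff.1 h))] at h₂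
  rw [h₃, Finset.card_pair (fun h => U.tail_ne_head (U.vertex_eq_head_iff.1 h))] at h₄
  have h₅ : Nat.card {r : U.Region // r ≠ U.starRegion} = Fintype.card U.Region - 1 := by
    rw [Nat.card_eq_fintype_card, Fintype.card_subtype_compl, Fintype.card_subtype_eq]
  have h₆ : 0 < Fintype.card U.Region := Fintype.card_pos_iff.2 ⟨U.starRegion⟩
  have h₇ : Nat.card {v : U.Vertex // U.IsCrossing v} =
      (Finset.univ.filter (fun v => U.IsCrossing v)).card := by
    rw [Nat.card_eq_fintype_card, Fintype.card_subtype]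
  simp only [Nat.card_eq_fintype_card, Finset.card_univ] at h₁ h₂ h₄
  rw [h₅, h₇]
  omega

/-! ### Potentials -/

open Classical in
theorem sum_vertex_rot [Fintype D] (g : D → ℚ) (v : U.Vertex) :
    ∑ d, (if U.vertex d = v then g (U.rot d) else 0) = ∑ d, if U.vertex d = v then g d else 0 := by
  rw [← Equiv.sum_comp U.rot (fun d => if U.vertex d = v then g d else 0)]
  simp only [vertex_rot]

open Classical in
theorem sum_region_rot [Fintype D] {g : D → ℚ} (hg : ∀ d, g (U.opp d) = g d) (r : U.Region) :
    ∑ d, (if U.region d = r then g (U.rot d) else 0) = ∑ d, if U.region d = r then g d else 0 := by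
  rw [← Equiv.sum_comp (U.rot⁻¹ * U.opp) (fun d => if U.region d = r then g (U.rot d) else 0)]
  simp only [Equiv.Perm.mul_apply, region_next, rot_apply_inv, hg]

open Classical in
/-- The first cohomology of the sphere vanishes: a function of corners that sums to zero around each
vertex and in each region is the difference of a function of edges along the corners. The functions
of the first kind contain those of the second kind, and by Euler's formula their dimensions agree,
since by connectedness there is only one relation among the sums and only the constant functions of
edges have zero differences. -/
theorem exists_potential [Fintype D] (f : D → ℚ)
    (hv : ∀ v, ∑ d, (if U.vertex d = v then f d else 0) = 0)
    (hr : ∀ r, ∑ d, (if U.region d = r then f d else 0) = 0) :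
    ∃ h : D → ℚ, (∀ d, h (U.opp d) = h d) ∧ ∀ d, h (U.rot d) - h d = f d := by
  have := Fintype.ofFinite U.Vertex
  have := Fintype.ofFinite U.Region
  have := Fintype.ofFinite (Quotient (Equiv.Perm.SameCycle.setoid U.opp))
  let P : Matrix (U.Vertex ⊕ U.Region) D ℚ := fun i d =>
    i.elim (fun v => if U.vertex d = v then 1 else 0) (fun r => if U.region d = r then 1 else 0)
  let B : (Quotient (Equiv.Perm.SameCycle.setoid U.opp) → ℚ) →ₗ[ℚ] (D → ℚ) :=
    LinearMap.funLeft ℚ ℚ (fun d => U.edge (U.rot d)) - LinearMap.funLeft ℚ ℚ U.edge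
  have hB : ∀ h d, B h d = h (U.edge (U.rot d)) - h (U.edge d) := fun h d => rfl
  have hPv : ∀ f v, P.mulVecLin f (Sum.inl v) = ∑ d, if U.vertex d = v then f d else 0 := by
    intro f v
    change ∑ d, (if U.vertex d = v then 1 else 0) * f d = _
    simp only [ite_mul, one_mul, zero_mul]
  have hPr : ∀ f r, P.mulVecLin f (Sum.inr r) = ∑ d, if U.region d = r then f d else 0 := by
    intro f r
    change ∑ d, (if U.region d = r then 1 else 0) * f d = _
    simp only [ite_mul, one_mul, zero_mul]
  have hPt : ∀ a d, P.transpose.mulVecLin a d =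
      a (Sum.inl (U.vertex d)) + a (Sum.inr (U.region d)) := by
    intro a d
    simp [P, Matrix.mulVec, dotProduct, Matrix.transpose]
  have hsub : ∀ (p : Prop) (a b : ℚ),
      (if p then a - b else 0) = (if p then a else 0) - if p then b else 0 := by
    intro p a b
    split_ifs <;> simp
  have hle : LinearMap.range B ≤ LinearMap.ker P.mulVecLin := by
    rintro _ ⟨h, rfl⟩
    rw [LinearMap.mem_ker]
    ext (v | r)
    · rw [hPv]
      simp only [hB, hsub, Finset.sum_sub_distrib]
      rw [U.sum_vertex_rot (fun d => h (U.edge d)), sub_self]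
      rfl
    · rw [hPr]
      simp only [hB, hsub, Finset.sum_sub_distrib]
      rw [U.sum_region_rot (g := fun d => h (U.edge d)) (fun d => by simp), sub_self]
      rfl
  have hkerB : Module.finrank ℚ (LinearMap.ker B) ≤ 1 := by
    let p : LinearMap.ker B →ₗ[ℚ] ℚ := LinearMap.proj (U.edge U.tail) ∘ₗ (LinearMap.ker B).subtype
    have hp : Function.Injective p := by
      rw [← LinearMap.ker_eq_bot, LinearMap.ker_eq_bot']
      rintro ⟨h, hh⟩ h0
      rw [LinearMap.mem_ker] at hh
      have hd : ∀ d, h (U.edge d) = 0 := fun d =>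
        (U.eq_of_invariant (h := fun d => h (U.edge d)) (fun d => by simp)
          (fun d => sub_eq_zero.1 (congrFun hh d)) d U.tail).trans h0
      ext e
      obtain ⟨d, rfl⟩ := U.edge_surjective e
      exact hd d
    simpa using LinearMap.finrank_le_finrank_of_injective hp
  have hkerP : Module.finrank ℚ (LinearMap.ker P.transpose.mulVecLin) ≤ 1 := by
    let p : LinearMap.ker P.transpose.mulVecLin →ₗ[ℚ] ℚ :=
      LinearMap.proj (Sum.inl (U.vertex U.tail)) ∘ₗ (LinearMap.ker P.transpose.mulVecLin).subtype
    have hp : Function.Injective p := by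
      rw [← LinearMap.ker_eq_bot, LinearMap.ker_eq_bot']
      rintro ⟨a, ha⟩ h0
      rw [LinearMap.mem_ker] at ha
      have had : ∀ d, a (Sum.inr (U.region d)) = - a (Sum.inl (U.vertex d)) := fun d => by
        rw [eq_neg_iff_add_eq_zero, add_comm, ← hPt, ha]
        rfl
      have hd : ∀ d, a (Sum.inl (U.vertex d)) = 0 := fun d => by
        refine (U.eq_of_invariant (h := fun d => a (Sum.inl (U.vertex d))) (fun d => ?_)
          (fun d => by simp) d U.tail).trans h0
        have := had (U.opp d)
        rw [region_opp, had, vertex_rot_inv] at this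
        exact (neg_injective this).symm
      ext (v | r)
      · obtain ⟨d, rfl⟩ := U.vertex_surjective v
        exact hd d
      · obtain ⟨d, rfl⟩ := U.region_surjective r
        change a _ = 0
        rw [had, hd, neg_zero]
    simpa using LinearMap.finrank_le_finrank_of_injective hp
  have heq : LinearMap.range B = LinearMap.ker P.mulVecLin := by
    refine Submodule.eq_of_le_of_finrank_le hle ?_
    have h₁ := B.finrank_range_add_finrank_ker
    have h₂ := P.mulVecLin.finrank_range_add_finrank_ker
    have h₃ := P.transpose.mulVecLin.finrank_range_add_finrank_ker
    have h₄ : Module.finrank ℚ (LinearMap.range P.transpose.mulVecLin) =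
      Module.finrank ℚ (LinearMap.range P.mulVecLin) := P.rank_transpose
    have h₅ := U.card_edge
    have h₆ := U.two_mul_card_vertex_add_card_region
    simp only [Module.finrank_fintype_fun_eq_card, Fintype.card_sum] at h₁ h₂ h₃
    simp only [Nat.card_eq_fintype_card] at h₅ h₆
    omega
  have hf : f ∈ LinearMap.ker P.mulVecLin := by
    rw [LinearMap.mem_ker]
    ext (v | r)
    · rw [hPv, hv]; rfl
    · rw [hPr, hr]; rfl
  rw [← heq] at hf
  obtain ⟨h, rfl⟩ := hf
  exact ⟨fun d => h (U.edge d), fun d => by simp, fun d => rfl⟩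

/-! ### Existence of a clock state -/

/-- All strands can be oriented: there is a set of outgoing half-edges. -/
theorem exists_orientation : ∃ O : Set D, (∀ d, U.opp d ∈ O ↔ d ∉ O) ∧
    ∀ d, U.IsCrossing (U.vertex d) → (U.rot (U.rot d) ∈ O ↔ d ∉ O) := by
  classical
  -- go straight on at each crossing, and from one endpoint to the other
  let b : D → D := fun d =>
    if d = U.tail then U.head else if d = U.head then U.tail else U.rot (U.rot d)
  have hbt : b U.tail = U.head := by simp [b]
  have hbh : b U.head = U.tail := by simp [b, U.tail_ne_head.symm]
  have hbc : ∀ d, U.IsCrossing (U.vertex d) → b d = U.rot (U.rot d) := fun d hd => by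
    rw [isCrossing_vertex_iff] at hd
    simp [b, hd.1, hd.2]
  have hcases : ∀ d, d = U.tail ∨ d = U.head ∨ U.IsCrossing (U.vertex d) := fun d => by
    rw [isCrossing_vertex_iff]
    tauto
  obtain ⟨O, h₁, h₂⟩ := exists_forall_apply_mem_iff_notMem (a := U.opp) (b := b) U.opp_opp U.opp_ne
    (fun d => by
      rcases hcases d with rfl | rfl | hd
      · rw [hbt, hbh]
      · rw [hbh, hbt]
      · rw [hbc d hd, hbc _ (by simpa using hd), rot_rot_rot_rot])
    (fun d => by
      rcases hcases d with rfl | rfl | hd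
      · rw [hbt]; exact U.tail_ne_head.symm
      · rw [hbh]; exact U.tail_ne_head
      · rw [hbc d hd]; exact U.rot_rot_ne hd)
  exact ⟨O, h₁, fun d hd => by rw [← hbc d hd, h₂]⟩

/-- The energy argument: let the strands be oriented and let `a` be a function of regions which
jumps by the same amount across the two outgoing half-edges of each crossing. Count the square of
the jump across each edge once at either end, with opposite signs. The total is zero, but the
contribution of a crossing is minus half the square of the difference of the jumps across the
incoming half-edges. So the square of the jump is the same across all edges, and it is zero at the
tail. -/
theorem region_eq_of_jump_eq [Fintype D] {O : Set D} (hO : ∀ d, U.opp d ∈ O ↔ d ∉ O)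
    (hO' : ∀ d, U.IsCrossing (U.vertex d) → (U.rot (U.rot d) ∈ O ↔ d ∉ O)) (a : U.Region → ℚ)
    (ha : ∀ d, U.IsCrossing (U.vertex d) → d ∈ O → U.rot d ∈ O →
      2 * a (U.region d) - a (U.region (U.rot d)) - a (U.region (U.rot⁻¹ d)) = 0)
    (r r' : U.Region) : a r = a r' := by
  classical
  let δ : D → ℚ := fun d => a (U.region d) - a (U.region (U.opp d))
  have hδ : ∀ d, δ d = a (U.region d) - a (U.region (U.rot (U.rot (U.rot d)))) := fun d => by
    rw [← rot_inv_apply, ← region_opp]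
  have hδo : ∀ d, δ (U.opp d) = - δ d := fun d => by simp [δ, U.opp_opp]
  -- `F` is the signed energy at a half-edge, and `G` is its sum around a vertex, counted four times
  -- at an endpoint, where it is zero anyway
  let F : D → ℚ := fun d => (if d ∈ O then 1 else -1) * δ d ^ 2
  have hF : ∑ d, F d = 0 := by
    have h₁ : ∑ d, F (U.opp d) = ∑ d, F d := Equiv.sum_comp U.opp F
    have h₂ : ∀ d, F (U.opp d) = - F d := fun d => by
      simp only [F, hδo, hO]
      by_cases hd : d ∈ O <;> simp [hd]
    simp only [h₂, Finset.sum_neg_distrib] at h₁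
    linarith
  let G : D → ℚ := fun d => F d + F (U.rot d) + F (U.rot (U.rot d)) + F (U.rot (U.rot (U.rot d)))
  have hG : ∑ d, G d = 0 := by
    have h₁ : ∀ g : D → ℚ, ∑ d, g (U.rot d) = ∑ d, g d := fun g => Equiv.sum_comp U.rot g
    simp only [G, Finset.sum_add_distrib]
    rw [h₁ (fun d => F (U.rot (U.rot d))), h₁ (fun d => F (U.rot d)), h₁ F, hF]
    simp
  let Q : D → Prop := fun d => G d ≤ 0 ∧ (G d = 0 → δ (U.rot d) ^ 2 = δ d ^ 2 ∧
    δ (U.rot (U.rot d)) ^ 2 = δ d ^ 2 ∧ δ (U.rot (U.rot (U.rot d))) ^ 2 = δ d ^ 2)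
  have hQr : ∀ d, Q d → Q (U.rot d) := by
    rintro d ⟨h₁, h₂⟩
    have : G (U.rot d) = G d := by
      simp only [G, rot_rot_rot_rot]
      ring
    refine ⟨by rwa [this], fun h => ?_⟩
    rw [this] at h
    obtain ⟨h₃, h₄, h₅⟩ := h₂ h
    simp only [rot_rot_rot_rot]
    exact ⟨by rw [h₃, h₄], by rw [h₃, h₅], by rw [h₃]⟩
  have hQO : ∀ d, U.IsCrossing (U.vertex d) → d ∈ O → U.rot d ∈ O → Q d := by
    intro d hd h₀ h₁
    have h₂ := (not_congr (hO' d hd)).2 (not_not.2 h₀)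
    have h₃ := (not_congr (hO' (U.rot d) (by simpa using hd))).2 (not_not.2 h₁)
    have e₁ := ha d hd h₀ h₁
    rw [rot_inv_apply] at e₁
    have d₀ := hδ d
    have d₁ := hδ (U.rot d)
    have d₂ := hδ (U.rot (U.rot d))
    have d₃ := hδ (U.rot (U.rot (U.rot d)))
    simp only [rot_rot_rot_rot] at d₁ d₂ d₃
    have e₂ : δ (U.rot d) = δ d := by linarith
    have e₃ : δ (U.rot (U.rot d)) = - 2 * δ d - δ (U.rot (U.rot (U.rot d))) := by linarith
    have e₄ : G d = - 2 * (δ d + δ (U.rot (U.rot (U.rot d)))) ^ 2 := by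
      simp only [G, F, h₀, h₁, h₂, h₃, if_true, if_false, e₂, e₃]
      ring
    refine ⟨by rw [e₄]; nlinarith [sq_nonneg (δ d + δ (U.rot (U.rot (U.rot d))))], fun h => ?_⟩
    have e₅ : δ (U.rot (U.rot (U.rot d))) = - δ d := by
      have : (δ d + δ (U.rot (U.rot (U.rot d)))) ^ 2 = 0 := by linarith
      have := pow_eq_zero_iff two_ne_zero |>.1 this
      linarith
    refine ⟨by rw [e₂], by rw [e₃, e₅]; ring, by rw [e₅]; ring⟩
  have hfix : ∀ d, U.rot d = d → δ d = 0 := fun d h => by rw [hδ, h, h, h, sub_self]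
  have hQ : ∀ d, Q d := by
    intro d
    by_cases hd : U.IsCrossing (U.vertex d)
    · have hr : ∀ d, Q (U.rot d) → Q d := fun d h => by
        have := hQr _ (hQr _ (hQr _ h))
        rwa [rot_rot_rot_rot] at this
      have h₂ := hO' d hd
      have h₃ := hO' (U.rot d) (by simpa using hd)
      by_cases h₀ : d ∈ O <;> by_cases h₁ : U.rot d ∈ O
      · exact hQO d hd h₀ h₁
      · refine hr _ (hr _ (hr _ (hQO _ (by simpa using hd) (h₃.2 h₁) ?_)))
        rwa [rot_rot_rot_rot]
      · exact hr _ (hQO _ (by simpa using hd) h₁ (h₂.2 h₀))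
      · exact hr _ (hr _ (hQO _ (by simpa using hd) (h₂.2 h₀) (h₃.2 h₁)))
    · have h : U.rot d = d := by
        rw [isCrossing_vertex_iff, not_and_or, not_not, not_not] at hd
        rcases hd with rfl | rfl
        exacts [U.rot_tail, U.rot_head]
      simp [Q, G, F, h, hfix d h]
  have hG0 : ∀ d, G d = 0 := fun d =>
    (Finset.sum_eq_zero_iff_of_nonpos (fun d _ => (hQ d).1)).1 hG d (Finset.mem_univ d)
  have hδ0 : ∀ d, δ d = 0 := fun d => by
    have := U.eq_of_invariant (h := fun d => δ d ^ 2) (fun d => by simp [hδo])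
      (fun d => ((hQ d).2 (hG0 d)).1) d U.tail
    simp only [hfix _ U.rot_tail] at this
    exact pow_eq_zero_iff two_ne_zero |>.1 (this.trans (zero_pow two_ne_zero))
  obtain ⟨d, rfl⟩ := U.region_surjective r
  obtain ⟨d', rfl⟩ := U.region_surjective r'
  refine U.eq_of_invariant (h := fun d => a (U.region d)) (fun d => ?_) (fun d => ?_) d d'
  · exact (sub_eq_zero.1 (hδ0 d)).symm
  · have := hδ (U.rot d)
    rw [hδ0, rot_rot_rot_rot] at this
    exact (sub_eq_zero.1 this.symm)

/-- A universe has a clock state. For oriented strands, the conditions of `region_eq_of_jump_eq`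
make up a square matrix, with a row for each crossing and a column for each unstarred region, whose
entries vanish unless the region has a corner at the crossing. This matrix is nonsingular, so one of
the products in the expansion of its determinant does not vanish. -/
theorem nonempty_clockState [Finite D] : Nonempty U.ClockState := by
  classical
  have := Fintype.ofFinite D
  have := Fintype.ofFinite U.Vertex
  have := Fintype.ofFinite U.Region
  obtain ⟨O, hO, hO'⟩ := U.exists_orientation
  let C := {v : U.Vertex // U.IsCrossing v}
  have hex : ∀ v : C, ∃ d, U.vertex d = v ∧ d ∈ O ∧ U.rot d ∈ O := by
    rintro ⟨v, hv⟩
    obtain ⟨d, rfl⟩ := U.vertex_surjective v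
    have h₂ := hO' d hv
    have h₃ := hO' (U.rot d) (by simpa using hv)
    by_cases h₀ : d ∈ O <;> by_cases h₁ : U.rot d ∈ O
    · exact ⟨d, rfl, h₀, h₁⟩
    · exact ⟨_, by simp, h₃.2 h₁, by rwa [rot_rot_rot_rot]⟩
    · exact ⟨_, by simp, h₁, h₂.2 h₀⟩
    · exact ⟨_, by simp, h₂.2 h₀, h₃.2 h₁⟩
  choose c hcv hc₀ hc₁ using hex
  have hc : ∀ d (hd : U.IsCrossing (U.vertex d)), d ∈ O → U.rot d ∈ O → d = c ⟨_, hd⟩ := by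
    intro d hd h₀ h₁
    have h₂ := hO' d hd
    have h₃ := hO' (U.rot d) (by simpa using hd)
    have h₄ := hc₀ ⟨_, hd⟩
    have h₅ := hc₁ ⟨_, hd⟩
    rcases U.eq_of_vertex_eq (hcv ⟨_, hd⟩) with h | h | h | h
    · exact h.symm
    · rw [h] at h₅; exact absurd h₀ (h₂.1 h₅)
    · rw [h] at h₄; exact absurd h₀ (h₂.1 h₄)
    · rw [h] at h₄; exact absurd h₁ (h₃.1 h₄)
  obtain ⟨e⟩ : Nonempty (C ≃ {r : U.Region // r ≠ U.starRegion}) :=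
    Finite.card_eq.1 U.card_unstarred.symm
  let I : D → C → ℚ := fun d w => if U.region d = e w then 1 else 0
  let M : Matrix C C ℚ := fun v w => 2 * I (c v) w - I (U.rot (c v)) w - I (U.rot⁻¹ (c v)) w
  have hdet : M.det ≠ 0 := by
    rw [Ne, ← Matrix.exists_mulVec_eq_zero_iff]
    rintro ⟨x, hx0, hx⟩
    let a : U.Region → ℚ := fun r =>
      if h : r ≠ U.starRegion then x (e.symm ⟨r, h⟩) else 0
    have hI : ∀ d, ∑ w, I d w * x w = a (U.region d) := by
      intro d
      by_cases hd : U.region d = U.starRegion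
      · rw [Finset.sum_eq_zero]
        · simp [a, hd]
        · intro w _
          simp [I, hd, (e w).2.symm]
      · rw [Finset.sum_eq_single (e.symm ⟨_, hd⟩)]
        · simp [I, a, hd]
        · intro w _ hw
          have : U.region d ≠ e w := fun h => hw (by simp [h])
          simp [I, this]
        · simp
    have hrow : ∀ v, 2 * a (U.region (c v)) - a (U.region (U.rot (c v))) -
        a (U.region (U.rot⁻¹ (c v))) = 0 := by
      intro v
      have := congrFun hx v
      change ∑ w, (2 * I (c v) w - I (U.rot (c v)) w - I (U.rot⁻¹ (c v)) w) * x w = 0 at this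
      rw [← hI, ← hI, ← hI, Finset.mul_sum, ← Finset.sum_sub_distrib, ← Finset.sum_sub_distrib,
        ← this]
      exact Finset.sum_congr rfl fun w _ => by ring
    have ha := U.region_eq_of_jump_eq hO hO' a (fun d hd h₀ h₁ => by
      rw [hc d hd h₀ h₁]
      exact hrow _)
    refine hx0 (funext fun w => ?_)
    have h₁ : a (e w) = x w := by simp [a, (e w).2]
    have h₂ : a U.starRegion = 0 := by simp [a]
    rw [← h₁, ha _ U.starRegion, h₂, Pi.zero_apply]
  rw [Matrix.det_apply] at hdet
  obtain ⟨σ, -, hσ⟩ := Finset.exists_ne_zero_of_sum_ne_zero hdet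
  have hσ' : ∀ w, M (σ w) w ≠ 0 := fun w h =>
    hσ ((congrArg (Equiv.Perm.sign σ • ·)
      (Finset.prod_eq_zero (f := fun i => M (σ i) i) (Finset.mem_univ w) h)).trans (smul_zero _))
  have hcorner : ∀ w, ∃ d, U.vertex d = σ w ∧ U.region d = e w := by
    intro w
    by_contra! h
    refine hσ' w ?_
    have h₁ := h (c (σ w)) (hcv _)
    have h₂ := h (U.rot (c (σ w))) (by rw [vertex_rot, hcv])
    have h₃ := h (U.rot⁻¹ (c (σ w))) (by rw [vertex_rot_inv, hcv])
    simp only [M, I, if_neg h₁, if_neg h₂, if_neg h₃]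
    norm_num
  choose m hmv hmr using hcorner
  refine ⟨⟨Set.range m, ?_, ?_, ?_, ?_⟩⟩
  · rintro _ ⟨w, rfl⟩
    rw [hmv]
    exact (σ w).2
  · rintro _ ⟨w, rfl⟩
    rw [hmr]
    exact (e w).2
  · intro r hr
    refine ⟨m (e.symm ⟨r, hr⟩), ⟨⟨_, rfl⟩, by simp [hmr]⟩, ?_⟩
    rintro _ ⟨⟨w, rfl⟩, h⟩
    congr 1
    rw [Equiv.eq_symm_apply]
    exact Subtype.ext ((hmr w).symm.trans h)
  · intro v hv
    refine ⟨m (σ.symm ⟨v, hv⟩), ⟨⟨_, rfl⟩, by simp [hmv]⟩, ?_⟩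
    rintro _ ⟨⟨w, rfl⟩, h⟩
    congr 1
    rw [Equiv.eq_symm_apply]
    exact Subtype.ext ((hmv w).symm.trans h)

/-! ### Cutting the universe along at most two edges -/

open Classical in
/-- An Euler inequality for the complement `M` of a set `N` of half-edges. The hypothesis says that
`N` is connected. By `exists_potential`, the functions of corners in `M` that sum to zero around
each vertex and in each region come from functions of edges, which are constant on `N` and can thus
be taken to vanish except on the edges with both halves in `M`. The number of equations is one less
than the number of vertices in `M` and regions that touch `M`, since one equation is redundant. -/
theorem card_add_one_le_of_connected [Fintype D] {N : Set D}
    (hconn : ∀ h : D → ℚ, (∀ d, h (U.opp d) = h d) → (∀ d ∈ N, h (U.rot d) = h d) →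
      ∀ d ∈ N, h d = h U.tail) {d₀ : D} (hd₀ : d₀ ∉ N) :
    (Finset.univ.filter (· ∉ N)).card + 1 ≤ ((Finset.univ.filter (· ∉ N)).image U.vertex).card +
      ((Finset.univ.filter (· ∉ N)).image U.region).card +
      ((Finset.univ.filter fun d => d ∉ N ∧ U.opp d ∉ N).image U.edge).card := by
  set M := Finset.univ.filter (· ∉ N) with hM
  set S := Finset.univ.filter fun d => d ∉ N ∧ U.opp d ∉ N with hS
  have hMmem : ∀ d, d ∈ M ↔ d ∉ N := by simp [hM]
  have hSmem : ∀ d, d ∈ S ↔ d ∉ N ∧ U.opp d ∉ N := by simp [hS]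
  set r₀ := U.region d₀ with hr₀
  have hr₀M : r₀ ∈ M.image U.region := Finset.mem_image_of_mem _ ((hMmem _).2 hd₀)
  let ext : (M → ℚ) →ₗ[ℚ] (D → ℚ) :=
    { toFun := fun f d => if h : d ∈ M then f ⟨d, h⟩ else 0
      map_add' := fun f g => by ext d; by_cases h : d ∈ M <;> simp [h]
      map_smul' := fun c f => by ext d; by_cases h : d ∈ M <;> simp [h] }
  have hext : ∀ f d (h : d ∈ M), ext f d = f ⟨d, h⟩ := fun f d h => dif_pos h
  have hext0 : ∀ f d, d ∉ M → ext f d = 0 := fun f d h => dif_neg h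
  let A : (M → ℚ) →ₗ[ℚ] ((M.image U.vertex ⊕ (M.image U.region).erase r₀) → ℚ) :=
    { toFun := fun f i => i.elim (fun v => ∑ d, if U.vertex d = v.1 then ext f d else 0)
        (fun r => ∑ d, if U.region d = r.1 then ext f d else 0)
      map_add' := fun f g => by
        ext (v | r) <;> simp [← Finset.sum_add_distrib, ← Finset.sum_filter]
      map_smul' := fun c f => by
        ext (v | r) <;> simp [Finset.mul_sum, ← Finset.sum_filter] }
  let B : (S.image U.edge → ℚ) →ₗ[ℚ] (M → ℚ) :=
    { toFun := fun h d => (if he : U.edge (U.rot d) ∈ S.image U.edge then h ⟨_, he⟩ else 0) -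
        if he : U.edge d ∈ S.image U.edge then h ⟨_, he⟩ else 0
      map_add' := fun f g => by
        ext d
        simp only [Pi.add_apply]
        split_ifs <;> ring
      map_smul' := fun c f => by
        ext d
        simp only [Pi.smul_apply, smul_eq_mul, RingHom.id_apply]
        split_ifs <;> ring }
  have hle : LinearMap.ker A ≤ LinearMap.range B := by
    intro f hf
    rw [LinearMap.mem_ker] at hf
    have hv : ∀ v, ∑ d, (if U.vertex d = v then ext f d else 0) = 0 := by
      intro v
      by_cases hvM : v ∈ M.image U.vertex
      · exact congrFun hf (Sum.inl ⟨v, hvM⟩)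
      · refine Finset.sum_eq_zero fun d _ => ?_
        split_ifs with h
        · exact hext0 f d fun hd => hvM (h ▸ Finset.mem_image_of_mem _ hd)
        · rfl
    have hr' : ∀ r, r ≠ r₀ → ∑ d, (if U.region d = r then ext f d else 0) = 0 := by
      intro r hr
      by_cases hrM : r ∈ M.image U.region
      · exact congrFun hf (Sum.inr ⟨r, Finset.mem_erase.2 ⟨hr, hrM⟩⟩)
      · refine Finset.sum_eq_zero fun d _ => ?_
        split_ifs with h
        · exact hext0 f d fun hd => hrM (h ▸ Finset.mem_image_of_mem _ hd)
        · rfl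
    have := Fintype.ofFinite U.Vertex
    have := Fintype.ofFinite U.Region
    have hr : ∀ r, ∑ d, (if U.region d = r then ext f d else 0) = 0 := by
      intro r
      by_cases h : r = r₀
      · -- the sum of all vertex sums is the sum of all region sums
        have h₁ : ∑ v, ∑ d, (if U.vertex d = v then ext f d else 0) = ∑ d, ext f d := by
          rw [Finset.sum_comm]
          simp
        have h₂ : ∑ r, ∑ d, (if U.region d = r then ext f d else 0) = ∑ d, ext f d := by
          rw [Finset.sum_comm]
          simp
        rw [Finset.sum_eq_single r₀ (fun r _ h => hr' r h) (by simp), ← h₁] at h₂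
        rw [h, h₂]
        exact Finset.sum_eq_zero fun v _ => hv v
      · exact hr' r h
    obtain ⟨h, ho, hh⟩ := U.exists_potential (ext f) hv hr
    have hN : ∀ d ∈ N, h d = h U.tail := hconn h ho fun d hd =>
      sub_eq_zero.1 ((hh d).trans (hext0 f d (by simpa [hMmem] using hd)))
    have hedge : ∀ d, (if U.edge d ∈ S.image U.edge then h (U.edge d).out - h U.tail else 0) =
        h d - h U.tail := by
      intro d
      split_ifs with hd
      · rcases U.eq_of_edge_eq (Quotient.out_eq (U.edge d)) with h' | h' <;> rw [h']
        rw [ho]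
      · by_cases hdN : d ∈ N
        · rw [hN d hdN, sub_self]
        · have : U.opp d ∈ N := by
            by_contra hdN'
            exact hd (Finset.mem_image_of_mem _ ((hSmem d).2 ⟨hdN, hdN'⟩))
          rw [← ho, hN _ this, sub_self]
    refine ⟨fun e => h e.1.out - h U.tail, ?_⟩
    ext ⟨d, hd⟩
    have h₁ := hedge (U.rot d)
    have h₂ := hedge d
    have h₃ := hh d
    rw [hext f d hd] at h₃
    change (if U.edge (U.rot d) ∈ S.image U.edge then h (U.edge (U.rot d)).out - h U.tail else 0) -
      (if U.edge d ∈ S.image U.edge then h (U.edge d).out - h U.tail else 0) = _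
    rw [h₁, h₂, ← h₃]
    ring
  have h₁ := A.finrank_range_add_finrank_ker
  have h₂ := B.finrank_range_add_finrank_ker
  have h₃ := Submodule.finrank_mono hle
  have h₄ := Submodule.finrank_le (LinearMap.range A)
  simp only [Module.finrank_fintype_fun_eq_card, Fintype.card_sum, Fintype.card_coe,
    Finset.card_erase_of_mem hr₀M] at h₁ h₂ h₄
  have h₅ := Finset.card_pos.2 ⟨_, hr₀M⟩
  omega

variable {U}

open Classical in
/-- If a connected set `N` of vertices that contains the tail is cut off by at most two edges, then
a marker in a region that touches `N` is at a vertex in `N`: by the Euler inequality, the crossings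
on the other side are no more than the regions that do not touch `N`, so that their markers are all
needed in these regions. -/
theorem ClockState.mem_of_region_eq [Fintype D] (s : U.ClockState) {N : Set D}
    (hrot : ∀ d, U.rot d ∈ N ↔ d ∈ N) (htail : U.tail ∈ N)
    (hconn : ∀ h : D → ℚ, (∀ d, h (U.opp d) = h d) → (∀ d ∈ N, h (U.rot d) = h d) →
      ∀ d ∈ N, h d = h U.tail)
    (hcut : (Finset.univ.filter fun d => d ∉ N ∧ U.opp d ∈ N).card ≤ 2)
    {z d : D} (hz : z ∈ s.markers) (hd : d ∈ N) (hdz : U.region d = U.region z) : z ∈ N := by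
  by_contra hzN
  have hEuler := U.card_add_one_le_of_connected hconn hzN
  set M := Finset.univ.filter (· ∉ N) with hM
  set S := Finset.univ.filter fun d => d ∉ N ∧ U.opp d ∉ N with hS
  set T := Finset.univ.filter fun d => d ∉ N ∧ U.opp d ∈ N with hT
  have hMmem : ∀ d, d ∈ M ↔ d ∉ N := by simp [hM]
  have hSmem : ∀ d, d ∈ S ↔ d ∉ N ∧ U.opp d ∉ N := by simp [hS]
  have hTmem : ∀ d, d ∈ T ↔ d ∉ N ∧ U.opp d ∈ N := by simp [hT]
  have hrot' : ∀ d, U.rot⁻¹ d ∈ N ↔ d ∈ N := fun d => by rw [← hrot, rot_apply_inv]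
  have hST : T.card + S.card = M.card := by
    rw [← Finset.card_filter_add_card_filter_not (s := M) (fun d => U.opp d ∈ N), hM,
      Finset.filter_filter, Finset.filter_filter]
  have hSedge := U.two_mul_card_image_edge S fun d h => by
    rw [hSmem] at h ⊢
    rw [U.opp_opp]
    exact h.symm
  have hdeg := U.card_add_three_mul M fun d h => by rwa [hMmem, hrot, ← hMmem]
  have hsplit := Finset.card_filter_add_card_filter_not (s := M.image U.vertex)
    (fun v => U.IsCrossing v)
  -- the only endpoint that can be outside of `N` is the head
  have hhead : ((M.image U.vertex).filter (fun v => ¬ U.IsCrossing v)).card ≤ 1 := by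
    rw [← Finset.card_singleton (U.vertex U.head)]
    refine Finset.card_le_card fun v hv => ?_
    obtain ⟨hv, hv'⟩ := Finset.mem_filter.1 hv
    obtain ⟨a, ha, rfl⟩ := Finset.mem_image.1 hv
    rw [isCrossing_vertex_iff, not_and_or, not_not, not_not] at hv'
    rcases hv' with rfl | rfl
    · exact absurd htail ((hMmem _).1 ha)
    · exact Finset.mem_singleton_self _
  let K := M.filter (· ∈ s.markers)
  have hK : K.card ≤ ((M.image U.vertex).filter (fun v => U.IsCrossing v)).card := by
    refine Finset.card_le_card_of_injOn U.vertex (fun a ha => ?_) fun a ha b hb hab => ?_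
    · obtain ⟨haM, has⟩ := Finset.mem_filter.1 ha
      exact Finset.mem_coe.2 (Finset.mem_filter.2
        ⟨Finset.mem_image_of_mem _ haM, s.isCrossing a has⟩)
    · have has := (Finset.mem_filter.1 ha).2
      have hbs := (Finset.mem_filter.1 hb).2
      exact (s.crossing_unique _ (s.isCrossing a has)).unique ⟨has, rfl⟩ ⟨hbs, hab.symm⟩
  have hzK : z ∈ K := Finset.mem_filter.2 ⟨(hMmem z).2 hzN, hz⟩
  have hinner : (M.image U.region) ⊆ T.image U.region ∪ (K.erase z).image U.region := by
    intro r hr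
    obtain ⟨a, ha, rfl⟩ := Finset.mem_image.1 hr
    rw [Finset.mem_union, or_iff_not_imp_left]
    intro hout
    -- the region does not touch `N`, as its boundary does not pass from `M` to `N`
    have hM' : ∀ b, U.region b = U.region a → b ∉ N := by
      have hnext : ∀ b, (U.region b = U.region a → b ∈ M → U.rot⁻¹ (U.opp b) ∈ M) := by
        intro b hb hbM
        rw [hMmem] at hbM ⊢
        rw [hrot']
        intro hbN
        exact hout (Finset.mem_image.2 ⟨b, (hTmem b).2 ⟨hbM, hbN⟩, hb⟩)
      intro b hb
      rw [← hMmem]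
      obtain ⟨i, -, rfl⟩ := (U.region_eq_iff.1 hb.symm).exists_pow_eq'
      clear hb
      suffices h : U.region (((U.rot⁻¹ * U.opp) ^ i) a) = U.region a ∧
        ((U.rot⁻¹ * U.opp) ^ i) a ∈ M from h.2
      induction i with
      | zero => exact ⟨rfl, ha⟩
      | succ i ih =>
        rw [pow_succ', Equiv.Perm.mul_apply, Equiv.Perm.mul_apply, region_next]
        exact ⟨ih.1, hnext _ ih.1 ih.2⟩
    have hstar : U.region a ≠ U.starRegion := fun h => hM' U.tail h.symm htail
    obtain ⟨m, ⟨hm, hma⟩, -⟩ := s.region_unique _ hstar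
    refine Finset.mem_image.2 ⟨m, Finset.mem_erase.2 ⟨?_, ?_⟩, hma⟩
    · rintro rfl
      exact hM' d (hdz.trans hma) hd
    · exact Finset.mem_filter.2 ⟨(hMmem m).2 (hM' m hma), hm⟩
  have hF := (Finset.card_le_card hinner).trans (Finset.card_union_le _ _)
  have hF₁ := Finset.card_image_le (s := T) (f := U.region)
  have hF₂ := Finset.card_image_le (s := K.erase z) (f := U.region)
  have hKz := Finset.card_erase_add_one hzK
  omega

/-! ### The potential drops under counterclockwise moves -/

namespace ClockState

theorem eq_of_vertex_eq (s : U.ClockState) {x y : D} (hx : x ∈ s.markers) (hy : y ∈ s.markers)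
    (h : U.vertex x = U.vertex y) : x = y :=
  (s.crossing_unique _ (s.isCrossing y hy)).unique ⟨hx, h⟩ ⟨hy, rfl⟩

theorem markers_injective : Function.Injective (ClockState.markers (U := U)) := by
  rintro ⟨m, _⟩ ⟨m', _⟩ h
  cases h
  rfl

instance [Finite D] : Finite U.ClockState := Finite.of_injective _ markers_injective

/-- Both kinds of clock moves in one form, in which a single turned marker is counted twice. -/
theorem Move.exists_markers {ρ : Equiv.Perm D} {s s' : U.ClockState} (h : s.Move ρ s') :
    ∃ x ∈ s.markers, ∃ y ∈ s.markers, U.region (ρ x) = U.region y ∧ U.region (ρ y) = U.region x ∧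
      s'.markers = (s.markers \ {x, y}) ∪ {ρ x, ρ y} := by
  rcases h with ⟨x, hx, hr, h⟩ | ⟨x, hx, y, hy, -, hr, hr', h⟩
  · exact ⟨x, hx, x, hx, hr, hr, by simpa using h⟩
  · exact ⟨x, hx, y, hy, hr, hr', h⟩

/-- The reverse of a clockwise move is a counterclockwise move. -/
theorem ClockwiseMove.symm {s s' : U.ClockState} (h : s.ClockwiseMove s') :
    s'.CounterclockwiseMove s := by
  have hnot : ∀ x ∈ s.markers, U.rot⁻¹ x ∉ s.markers := fun x hx hx' => by
    have := s.eq_of_vertex_eq hx' hx (U.vertex_rot_inv x)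
    rw [Equiv.Perm.inv_eq_iff_eq] at this
    exact U.rot_ne (s.isCrossing x hx) this.symm
  rcases h with ⟨x, hx, hr, h⟩ | ⟨x, hx, y, hy, hxy, hr, hr', h⟩
  · refine Or.inl ⟨U.rot⁻¹ x, by simp [h], by rw [rot_apply_inv, hr], ?_⟩
    have := hnot x hx
    rw [h, rot_apply_inv]
    generalize U.rot⁻¹ x = x' at this
    ext a
    simp only [Set.mem_union, Set.mem_sdiff, Set.mem_singleton_iff]
    grind
  · refine Or.inr ⟨U.rot⁻¹ x, by simp [h], U.rot⁻¹ y, by simp [h], by simpa using hxy,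
      by rw [rot_apply_inv, hr'], by rw [rot_apply_inv, hr], ?_⟩
    have h₃ := hnot x hx
    have h₄ := hnot y hy
    rw [h, rot_apply_inv, rot_apply_inv]
    generalize U.rot⁻¹ x = x' at h₃
    generalize U.rot⁻¹ y = y' at h₄
    ext a
    simp only [Set.mem_union, Set.mem_sdiff, Set.mem_insert_iff, Set.mem_singleton_iff]
    grind

open Classical in
/-- The indicator function of the markers. -/
noncomputable def weight (s : U.ClockState) (d : D) : ℚ := if d ∈ s.markers then 1 else 0

open Classical in
theorem sum_weight_vertex [Fintype D] (s : U.ClockState) (v : U.Vertex) :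
    ∑ d, (if U.vertex d = v then s.weight d else 0) = if U.IsCrossing v then 1 else 0 := by
  split_ifs with hv
  · obtain ⟨x, ⟨hx, rfl⟩, hu⟩ := s.crossing_unique v hv
    rw [Finset.sum_eq_single x]
    · simp [weight, hx]
    · intro y _ hy
      split_ifs with h
      · exact if_neg fun hys => hy (hu y ⟨hys, h⟩)
      · rfl
    · simp
  · refine Finset.sum_eq_zero fun d _ => ?_
    split_ifs with h
    · exact if_neg fun hd => hv (h ▸ s.isCrossing d hd)
    · rfl

open Classical in
theorem sum_weight_region [Fintype D] (s : U.ClockState) (r : U.Region) :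
    ∑ d, (if U.region d = r then s.weight d else 0) = if r ≠ U.starRegion then 1 else 0 := by
  split_ifs with hr
  · obtain ⟨x, ⟨hx, rfl⟩, hu⟩ := s.region_unique r hr
    rw [Finset.sum_eq_single x]
    · simp [weight, hx]
    · intro y _ hy
      split_ifs with h
      · exact if_neg fun hys => hy (hu y ⟨hys, h⟩)
      · rfl
    · simp
  · refine Finset.sum_eq_zero fun d _ => ?_
    split_ifs with h
    · exact if_neg fun hd => hr (h ▸ s.not_star d hd)
    · rfl

/-- Any two states differ by a potential which is zero at the tail. -/
theorem exists_potential [Finite D] (s₀ s : U.ClockState) :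
    ∃ h : D → ℚ, (∀ d, h (U.opp d) = h d) ∧ (∀ d, h (U.rot d) - h d = s.weight d - s₀.weight d) ∧
      h U.tail = 0 := by
  classical
  have := Fintype.ofFinite D
  have hsub : ∀ (p : Prop) (a b : ℚ),
      (if p then a - b else 0) = (if p then a else 0) - if p then b else 0 := by
    intro p a b
    split_ifs <;> simp
  obtain ⟨h, ho, hh⟩ := U.exists_potential (fun d => s.weight d - s₀.weight d)
    (fun v => by
      simp only [hsub, Finset.sum_sub_distrib]
      rw [sum_weight_vertex, sum_weight_vertex, sub_self])
    (fun r => by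
      simp only [hsub, Finset.sum_sub_distrib]
      rw [sum_weight_region, sum_weight_region, sub_self])
  exact ⟨fun d => h d - h U.tail, fun d => by simp only [ho], fun d => by rw [← hh]; ring,
    sub_self _⟩

/-- The effect of a counterclockwise move on a potential: it drops by one on the edges that the
markers pass and on the part of the universe which these edges cut off from the tail, and is
unchanged elsewhere. The point is that the turned markers are on the side of the tail, by
`ClockState.mem_of_region_eq`. -/
theorem CounterclockwiseMove.potential_nonpos [Finite D] {s s' : U.ClockState}
    (hs : s.CounterclockwiseMove s') {g : D → ℚ} (ho : ∀ d, g (U.opp d) = g d)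
    (hg : ∀ d, g (U.rot d) - g d = s'.weight d - s.weight d) (ht : g U.tail = 0) :
    (∀ d, g d ≤ 0) ∧ ∃ d, g d < 0 := by
  classical
  have := Fintype.ofFinite D
  obtain ⟨x, hx, y, hy, hxy, hyx, hs'⟩ := Move.exists_markers hs
  let passed : D → Prop := fun d => d = U.rot x ∨ d = U.rot y
  have hpassed : ∀ d, passed d → ¬ d = U.tail := by
    rintro d hd rfl
    rcases hd with h | h
    · exact (U.isCrossing_vertex_iff.1 (by simpa using s.isCrossing x hx)).1 h.symm
    · exact (U.isCrossing_vertex_iff.1 (by simpa using s.isCrossing y hy)).1 h.symm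
  let b : D → ℚ := fun d => if passed d then 1 else 0
  have hb1 : ∀ d, passed d → b d = 1 := fun d hd => if_pos hd
  have hb0 : ∀ d, ¬ passed d → b d = 0 := fun d hd => if_neg hd
  -- the function `g + b` is constant around each vertex
  have hgb : ∀ d, g (U.rot d) + b (U.rot d) = g d + b d := by
    intro d
    have hnot : passed d → d ∉ s.markers := by
      rintro (rfl | rfl) h
      · exact U.rot_ne (s.isCrossing x hx) (s.eq_of_vertex_eq h hx (U.vertex_rot x))
      · exact U.rot_ne (s.isCrossing y hy) (s.eq_of_vertex_eq h hy (U.vertex_rot y))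
    have hrot : passed (U.rot d) ↔ d = x ∨ d = y := by simp [passed]
    have hmem : d ∈ s'.markers ↔ (d ∈ s.markers ∧ ¬ (d = x ∨ d = y)) ∨ passed d := by
      simp [hs', passed, or_comm, or_left_comm]
    have hdmem : d = x ∨ d = y → d ∈ s.markers := by rintro (rfl | rfl) <;> assumption
    have := hg d
    simp only [weight, hmem] at this
    simp only [b, hrot]
    by_cases h₁ : passed d <;> by_cases h₂ : d = x ∨ d = y <;> by_cases h₃ : d ∈ s.markers <;>
      simp only [h₁, h₂, h₃, or_true, not_true_eq_false, not_false_eq_true, and_true,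
        and_false, or_false, if_true, if_false] at this hnot hdmem ⊢ <;>
      first | linarith | exact absurd trivial hnot | exact absurd trivial hdmem
  -- the part of the universe that is joined to the tail without the passed edges
  let step : D → D → Prop := fun d e => e = U.rot d ∨ d = U.rot e ∨
    (e = U.opp d ∧ ¬ passed d ∧ ¬ passed (U.opp d))
  let N : Set D := {d | Relation.ReflTransGen step U.tail d}
  have hNt : U.tail ∈ N := Relation.ReflTransGen.refl
  have hNr : ∀ d, U.rot d ∈ N ↔ d ∈ N := fun d =>
    ⟨fun h => h.tail (Or.inr (Or.inl rfl)), fun h => h.tail (Or.inl rfl)⟩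
  have hNo : ∀ d ∈ N, ¬ passed d → ¬ passed (U.opp d) → U.opp d ∈ N := fun d h h₁ h₂ =>
    h.tail (Or.inr (Or.inr ⟨rfl, h₁, h₂⟩))
  have hconn : ∀ h : D → ℚ, (∀ d, ¬ passed d → ¬ passed (U.opp d) → h (U.opp d) = h d) →
      (∀ d ∈ N, h (U.rot d) = h d) → ∀ d ∈ N, h d = h U.tail := by
    intro h h₁ h₂ d hd
    change Relation.ReflTransGen step U.tail d at hd
    induction hd with
    | refl => rfl
    | @tail d e hd hde ih =>
      rcases hde with rfl | rfl | ⟨rfl, h₃, h₄⟩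
      · rw [h₂ d hd, ih]
      · rw [← ih, h₂ e ((hNr e).1 hd)]
      · rw [h₁ d h₃ h₄, ih]
  have hcut : ∀ d, d ∉ N → U.opp d ∈ N → passed d ∨ passed (U.opp d) := by
    intro d hd hdo
    by_contra! h
    have := hNo _ hdo h.2 (by rw [U.opp_opp]; exact h.1)
    rw [U.opp_opp] at this
    exact hd this
  have hcard : (Finset.univ.filter fun d => d ∉ N ∧ U.opp d ∈ N).card ≤ 2 := by
    -- on each of the two edges, at most one half is outside of `N`
    have : (Finset.univ.filter fun d => d ∉ N ∧ U.opp d ∈ N).card ≤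
        ({U.edge (U.rot x), U.edge (U.rot y)} : Finset _).card := by
      refine Finset.card_le_card_of_injOn U.edge (fun d hd => ?_) fun d hd e he h => ?_
      · obtain ⟨-, h₁, h₂⟩ := Finset.mem_filter.1 hd
        rw [Finset.mem_coe, Finset.mem_insert, Finset.mem_singleton]
        rcases hcut d h₁ h₂ with (h | h) | h | h
        · exact Or.inl (by rw [h])
        · exact Or.inr (by rw [h])
        · exact Or.inl (by rw [← h, edge_opp])
        · exact Or.inr (by rw [← h, edge_opp])
      · obtain ⟨-, h₁, h₂⟩ := Finset.mem_filter.1 hd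
        obtain ⟨-, h₃, h₄⟩ := Finset.mem_filter.1 he
        rcases U.eq_of_edge_eq h with h | h
        · exact h
        · exact absurd (h ▸ h₄) h₁
    exact this.trans Finset.card_le_two
  have hconn' : ∀ h : D → ℚ, (∀ d, h (U.opp d) = h d) → (∀ d ∈ N, h (U.rot d) = h d) →
      ∀ d ∈ N, h d = h U.tail := fun h h₁ => hconn h fun d _ _ => h₁ d
  -- both regions involved in the move touch `N`, as a passed edge leads out of `N`
  have hregions : ∀ d, d ∉ N → ∀ z, z = x ∨ z = y → ∃ e ∈ N, U.region e = U.region z := by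
    intro d hd
    obtain ⟨c, hc, hco⟩ : ∃ c, c ∉ N ∧ U.opp c ∈ N := by
      by_contra! h
      have hN : ∀ c, (U.opp c ∈ N) = (c ∈ N) := fun c => propext
        ⟨fun h₁ => by_contra fun h₂ => h c h₂ h₁, fun h₁ => by_contra fun h₂ => by
          have := h _ h₂
          rw [U.opp_opp] at this
          exact this h₁⟩
      have := U.eq_of_invariant (h := fun c => c ∈ N) hN (fun c => propext (hNr c)) d U.tail
      exact hd (this.mpr hNt)
    have h₁ : ∃ e ∈ N, U.region e = U.region c :=
      ⟨U.rot⁻¹ (U.opp c), by rwa [← hNr, rot_apply_inv], U.region_next c⟩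
    have h₂ : ∃ e ∈ N, U.region e = U.region (U.opp c) := ⟨_, hco, rfl⟩
    have hsides : ∀ z, U.region (U.opp (U.rot z)) = U.region z := fun z => by
      rw [region_opp]; exact congrArg U.region (Equiv.symm_apply_apply _ _)
    rintro z (rfl | rfl) <;> rcases hcut c hc hco with (h | h) | h | h
    · rwa [h, hsides] at h₂
    · rwa [h, hyx] at h₁
    · rwa [← U.opp_opp c, h, hsides] at h₁
    · rwa [h, hyx] at h₂
    · rwa [h, hxy] at h₁
    · rwa [h, hsides] at h₂
    · rwa [h, hxy] at h₂
    · rwa [← U.opp_opp c, h, hsides] at h₁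
  have hmem : ∀ z ∈ s.markers, z = x ∨ z = y → z ∈ N := by
    intro z hz hzxy
    by_contra hzN
    obtain ⟨e, he, hez⟩ := hregions z hzN z hzxy
    exact hzN (s.mem_of_region_eq hNr hNt hconn' hcard hz he hez)
  have hpN : ∀ d, passed d → d ∈ N := by
    rintro d (rfl | rfl)
    · exact (hNr x).2 (hmem x hx (Or.inl rfl))
    · exact (hNr y).2 (hmem y hy (Or.inr rfl))
  have hN0 : ∀ d ∈ N, g d + b d = 0 := by
    intro d hd
    rw [hconn (fun d => g d + b d) (fun d h₁ h₂ => by rw [ho, hb0 _ h₁, hb0 _ h₂])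
      (fun d _ => hgb d) d hd, ht, hb0 _ fun h => hpassed _ h rfl, add_zero]
  -- outside of `N` the potential is `-1`, as each path to the tail enters `N` along a passed edge
  have hall : ∀ d, d ∈ N ∨ g d + b d = -1 := by
    have hopp : ∀ d, (d ∈ N ∨ g d + b d = -1) → (U.opp d ∈ N ∨ g (U.opp d) + b (U.opp d) = -1) := by
      intro d hd
      by_cases h₁ : passed (U.opp d)
      · exact Or.inl (hpN _ h₁)
      rw [ho, hb0 _ h₁, add_zero]
      by_cases h₂ : passed d
      · have := hN0 d (hpN d h₂)
        rw [hb1 d h₂] at this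
        exact Or.inr (by linarith)
      · rw [hb0 _ h₂, add_zero] at hd
        exact hd.imp_left fun h => hNo d h h₂ h₁
    have hiff : ∀ d, (U.opp d ∈ N ∨ g (U.opp d) + b (U.opp d) = -1) =
        (d ∈ N ∨ g d + b d = -1) := fun d => propext
      ⟨fun h => by have := hopp _ h; rwa [U.opp_opp] at this, hopp d⟩
    intro d
    have := U.eq_of_invariant (h := fun d => d ∈ N ∨ g d + b d = -1) hiff
      (fun d => by simp only [hNr, hgb]) d U.tail
    exact this.mpr (Or.inl hNt)
  have hb : ∀ d, 0 ≤ b d := fun d => by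
    by_cases h : passed d
    · rw [hb1 d h]; exact zero_le_one
    · rw [hb0 d h]
  refine ⟨fun d => ?_, U.rot x, ?_⟩
  · rcases hall d with h | h
    · linarith [hN0 d h, hb d]
    · linarith [hb d]
  · have h : passed (U.rot x) := Or.inl rfl
    linarith [hN0 _ (hpN _ h), hb1 _ h]

/-- There is a function on the clock states that decreases under counterclockwise moves: the total
of the potential relative to a fixed state. -/
theorem exists_strictAnti [Finite D] (s₀ : U.ClockState) :
    ∃ H : U.ClockState → ℚ, ∀ s s' : U.ClockState, s.CounterclockwiseMove s' → H s' < H s := by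
  have := Fintype.ofFinite D
  choose h ho hh ht using s₀.exists_potential
  refine ⟨fun s => ∑ d, h s d, fun s s' hs => ?_⟩
  obtain ⟨h₁, d, h₂⟩ := hs.potential_nonpos (g := fun d => h s' d - h s d)
    (fun d => by rw [ho, ho]) (fun d => by linarith [hh s d, hh s' d]) (by rw [ht, ht, sub_self])
  exact Finset.sum_lt_sum (fun d _ => sub_nonpos.1 (h₁ d)) ⟨d, Finset.mem_univ d, sub_neg.1 h₂⟩

end ClockState

end OneLinkoidUniverse

theorem mainTheorem2 {D : Type*} [Finite D] (U : OneLinkoidUniverse D) :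
    (∃ s : U.ClockState, s.IsClocked) ∧ (∃ s : U.ClockState, s.IsCounterClocked) := by
  have := U.nonempty_clockState
  obtain ⟨H, hH⟩ :=
    OneLinkoidUniverse.ClockState.exists_strictAnti (Classical.arbitrary U.ClockState)
  obtain ⟨s, hs⟩ := Finite.exists_min H
  obtain ⟨t, ht⟩ := Finite.exists_max H
  exact ⟨⟨s, fun ⟨s', h⟩ => (hs s').not_gt (hH s s' h)⟩,
    ⟨t, fun ⟨t', h⟩ => (ht t').not_gt (hH t' t h.symm)⟩⟩
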